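/- Let $A$ be a C$^*$-algebra (not necessarily unital) and let $E$ be a right Hilbert C$^*$-module over $A$, with $A$-valued inner product $\langle\cdot,\cdot\rangle$, complex linear in the second variable and conjugate linear in the first, and norm $\|x\|^2=\|\langle x,x\rangle\|$. For $x,y,z\in E$ put $|x|=\langle x,x\rangle^{1/2}\in A$, $(x\otimes y^*)(z)=x.\langle y,z\rangle$ and $\{x,y,z\}=\tfrac12\big(x.\langle y,z\rangle+z.\langle y,x\rangle\big)$, and for $c\in E$ let $$B(c,c)(x)=x-2\{c,c,x\}+\{c,\{c,x,c\},c\},\qquad x\in E,$$ be the Bergman operator. Here $\mathbf 1$ is the unit of the unitization of $A$, which acts on $E$ by $x.(\lambda\mathbf 1+a)=\lambda x+x.a$. Let $\operatorname{Extr}B_E$ be the set of extreme points of the closed unit ball $B_E$ of $E$. Then: 1. $\operatorname{Extr}B_E=\{c\in E: B(c,c)=0\}$; 2. $c\in E$ belongs to $\operatorname{Extr}B_E$ if and only if $(\mathrm{Id}-c\otimes c^*)\big(x.(\mathbf 1-|c|^2)\big)=0$ for all $x\in E$; 3. if $c\in E$ and $E.(\mathbf 1-|c|)=\{0\}$, then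 $c\in\operatorname{Extr}B_E$; 4. if $c\in E$ and $(\mathrm{Id}-c\otimes c^*)E=\{0\}$, then $c\in\operatorname{Extr}B_E$; 5. every $c\in\operatorname{Extr}B_E$ is a tripotent: $c=\{c,c,c\}=c.\langle c,c\rangle$. -/

import Mathlib

open scoped RightActions InnerProductSpace

/-- Right Hilbert C⋆-modules over a (not necessarily unital) C⋆-algebra `A`. The right action of
`a : A` on `x : E` is `x <• a`, the inner product `⟪x, y⟫_A` takes values in `A`, is complex linear
in the second variable and conjugate linear in the first, and induces the norm of `E`.
(Mathlib's `CStarModule` is the mirror notion, for which `⟪x, a • y⟫_A = a * ⟪x, y⟫_A`.)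
Completeness of `E` is the separate type class `CompleteSpace E`. -/
class RightHilbertModule (A E : Type*) [NonUnitalCStarAlgebra A] [PartialOrder A]
    [StarOrderedRing A] [NormedAddCommGroup E] [NormedSpace ℂ E] [SMul Aᵐᵒᵖ E]
    extends Inner A E where
  add_act (x y : E) (a : A) : (x + y) <• a = x <• a + y <• a
  act_add (x : E) (a b : A) : x <• (a + b) = x <• a + x <• b
  act_mul (x : E) (a b : A) : x <• (a * b) = (x <• a) <• b
  smul_act (z : ℂ) (x : E) (a : A) : (z • x) <• a = z • (x <• a)
  act_smul (z : ℂ) (x : E) (a : A) : x <• (z • a) = z • (x <• a)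
  inner_add_right (x y z : E) : ⟪x, y + z⟫_A = ⟪x, y⟫_A + ⟪x, z⟫_A
  inner_smul_right (z : ℂ) (x y : E) : ⟪x, z • y⟫_A = z • ⟪x, y⟫_A
  inner_act_right (x y : E) (a : A) : ⟪x, y <• a⟫_A = ⟪x, y⟫_A * a
  star_inner (x y : E) : star ⟪x, y⟫_A = ⟪y, x⟫_A
  inner_self_nonneg (x : E) : 0 ≤ ⟪x, x⟫_A
  eq_zero_of_inner_self (x : E) : ⟪x, x⟫_A = 0 → x = 0
  norm_sq_eq (x : E) : ‖x‖ ^ 2 = ‖⟪x, x⟫_A‖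

namespace RightHilbertModule

variable (A : Type*) {E : Type*} [NonUnitalCStarAlgebra A] [PartialOrder A]
  [StarOrderedRing A] [NormedAddCommGroup E] [NormedSpace ℂ E] [SMul Aᵐᵒᵖ E]
  [RightHilbertModule A E]

theorem inner_add_left (x y z : E) : ⟪x + y, z⟫_A = ⟪x, z⟫_A + ⟪y, z⟫_A := by
  rw [← star_inner z (x + y), inner_add_right, star_add, star_inner, star_inner]

theorem inner_smul_left (z : ℂ) (x y : E) : ⟪z • x, y⟫_A = star z • ⟪x, y⟫_A := by
  rw [← star_inner y (z • x), inner_smul_right, star_smul, star_inner]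

/-- The `A`-valued norm `|x| = ⟨x, x⟩^{1/2}`. -/
noncomputable def absVal (x : E) : A := CFC.sqrt ⟪x, x⟫_A

variable {A} in
/-- The right action on `E` of the unitization `A⁺¹ = ℂ ⊕ A`, which gives a meaning to
`x.(1 - a)` when `A` has no unit: `x.(z + a) = z x + x.a`. If `A` has a unit `e`, then `x.e = x`
in `E`, so that nothing depends on whether `1` is read in `A` or in `A⁺¹`. -/
noncomputable def unitAct (x : E) (u : Unitization ℂ A) : E := u.fst • x + x <• u.snd

/-- The operator `x ⊗ y⋆ : z ↦ x.⟨y, z⟩`. -/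
noncomputable def theta (x y : E) : E →ₗ[ℂ] E where
  toFun z := x <• ⟪y, z⟫_A
  map_add' u v := by rw [inner_add_right, act_add]
  map_smul' w u := by rw [inner_smul_right, act_smul]; rfl

/-- The triple product, `2 {x, y, z} = x.⟨y, z⟩ + z.⟨y, x⟩`. -/
noncomputable def triple (x y z : E) : E :=
  (2⁻¹ : ℂ) • (x <• ⟪y, z⟫_A + z <• ⟪y, x⟫_A)

theorem triple_add_right (x y u v : E) :
    triple A x y (u + v) = triple A x y u + triple A x y v := by
  simp only [triple, inner_add_right, act_add, add_act, smul_add]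
  abel

theorem triple_smul_right (w : ℂ) (x y z : E) :
    triple A x y (w • z) = w • triple A x y z := by
  simp only [triple, inner_smul_right, act_smul, smul_act, smul_add, smul_comm w]

theorem triple_add_middle (x u v z : E) :
    triple A x (u + v) z = triple A x u z + triple A x v z := by
  simp only [triple, inner_add_left, act_add, smul_add]
  abel

theorem triple_smul_middle (w : ℂ) (x y z : E) :
    triple A x (w • y) z = star w • triple A x y z := by
  simp only [triple, inner_smul_left, act_smul, smul_add, smul_comm (star w)]

/-- The Bergman operator of the triple product, with `(a □ b) x = {a, b, x}` and
`Q_a x = {a, x, a}`: `B(a, b) = Id - 2 (a □ b) + Q_a Q_b`. -/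
noncomputable def bergman (a b : E) : E →ₗ[ℂ] E where
  toFun x := x - (2 : ℂ) • triple A a b x + triple A a (triple A b x b) a
  map_add' u v := by
    simp only [triple_add_right, triple_add_middle, smul_add]
    abel
  map_smul' w u := by
    simp only [triple_smul_right, triple_smul_middle, star_star, RingHom.id_apply, smul_add,
      smul_sub, smul_comm w]

/-- The set of extreme points of the closed unit ball of `E`. -/
def extrBall (E : Type*) [NormedAddCommGroup E] [NormedSpace ℂ E] : Set E :=
  Set.extremePoints ℝ (Metric.closedBall (0 : E) 1)

end RightHilbertModule

namespace RightHilbertModule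

section Basic

variable {A E : Type*} [NonUnitalCStarAlgebra A] [PartialOrder A] [StarOrderedRing A]
  [NormedAddCommGroup E] [NormedSpace ℂ E] [SMul Aᵐᵒᵖ E] [RightHilbertModule A E]

/-! Write `p = ⟪c, c⟫`. The Bergman operator factors as `B(c,c)x = (1 - c ⊗ c⋆)(x - x.p)`, so its
vanishing says that no nonzero vector is orthogonal to `c` on both sides (`⟪c, y⟫ = 0` and `y.p =
0`) once `c = c.p`. If `c` is extreme, a spectral perturbation forces `c = c.p`, and a nonzero
two-sided orthogonal `y`, normalized, would give `‖c ± y‖ ≤ 1`. Conversely, `B(c,c) = 0` forces `c =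
c.p`, so `p` is a projection, and `‖c ± x‖ ≤ 1` forces `x.p = 0` and `⟪c, x⟫ = 0`, hence `x = 0`. -/

theorem act_zero (x : E) : x <• (0 : A) = 0 := by
  simpa using act_smul (0 : ℂ) x (0 : A)

theorem neg_act (x : E) (a : A) : (-x) <• a = -(x <• a) := by
  simpa using smul_act (-1 : ℂ) x a

theorem act_neg (x : E) (a : A) : x <• (-a) = -(x <• a) := by
  simpa using act_smul (-1 : ℂ) x a

theorem sub_act (x y : E) (a : A) : (x - y) <• a = x <• a - y <• a := by
  rw [sub_eq_add_neg, add_act, neg_act, sub_eq_add_neg]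

theorem act_sub (x : E) (a b : A) : x <• (a - b) = x <• a - x <• b := by
  rw [sub_eq_add_neg, act_add, act_neg, sub_eq_add_neg]

variable (A) in
theorem inner_zero_right (x : E) : ⟪x, (0 : E)⟫_A = 0 := by
  simpa using inner_smul_right (A := A) (0 : ℂ) x (0 : E)

variable (A) in
theorem inner_neg_right (x y : E) : ⟪x, -y⟫_A = -⟪x, y⟫_A := by
  simpa using inner_smul_right (A := A) (-1 : ℂ) x y

variable (A) in
theorem inner_sub_right (x y z : E) : ⟪x, y - z⟫_A = ⟪x, y⟫_A - ⟪x, z⟫_A := by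
  rw [sub_eq_add_neg, inner_add_right, inner_neg_right, sub_eq_add_neg]

variable (A) in
theorem inner_neg_left (x y : E) : ⟪-x, y⟫_A = -⟪x, y⟫_A := by
  simpa using inner_smul_left A (-1 : ℂ) x y

variable (A) in
theorem inner_sub_left (x y z : E) : ⟪x - y, z⟫_A = ⟪x, z⟫_A - ⟪y, z⟫_A := by
  rw [sub_eq_add_neg, inner_add_left, inner_neg_left, sub_eq_add_neg]

theorem inner_act_left (x y : E) (a : A) : ⟪x <• a, y⟫_A = star a * ⟪x, y⟫_A := by
  rw [← star_inner y (x <• a), inner_act_right, star_mul, star_inner]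

variable (A) in
theorem isSelfAdjoint_inner_self (x : E) : IsSelfAdjoint ⟪x, x⟫_A :=
  star_inner x x

variable (A) in
theorem star_inner_self (x : E) : star ⟪x, x⟫_A = ⟪x, x⟫_A :=
  star_inner x x

variable (A) in
theorem norm_le_one_iff (x : E) : ‖x‖ ≤ 1 ↔ ‖⟪x, x⟫_A‖ ≤ 1 := by
  rw [← norm_sq_eq, sq_le_one_iff₀ (norm_nonneg x)]

theorem absVal_mul_absVal (c : E) : absVal A c * absVal A c = ⟪c, c⟫_A :=
  CFC.sqrt_mul_sqrt_self _ (inner_self_nonneg c)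

theorem one_sub_theta_apply (c x : E) : (1 - theta A c c) x = x - c <• ⟪c, x⟫_A := rfl

theorem unitAct_one_sub_inr (x : E) (a : A) :
    unitAct x (1 - (a : Unitization ℂ A)) = x - x <• a := by
  simpa [unitAct, sub_eq_add_neg] using act_neg x a

theorem unitAct_one_sub_absVal_sq (c x : E) :
    unitAct x (1 - (absVal A c : Unitization ℂ A) ^ 2) = x - x <• ⟪c, c⟫_A := by
  rw [sq, ← Unitization.inr_mul, absVal_mul_absVal, unitAct_one_sub_inr]

/-! ### Vanishing Bergman operator implies extremality. -/

theorem triple_self_outer (a b : E) : triple A a b a = a <• ⟪b, a⟫_A := by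
  rw [triple, ← two_smul ℂ, smul_smul, inv_mul_cancel₀ two_ne_zero, one_smul]

theorem bergman_self_apply (c x : E) :
    bergman A c c x = (1 - theta A c c) (x - x <• ⟪c, c⟫_A) := by
  have h : bergman A c c x =
      x - (2 : ℂ) • triple A c c x + triple A c (triple A c x c) c := rfl
  rw [h, triple_self_outer, triple_self_outer, one_sub_theta_apply, triple, smul_smul,
    mul_inv_cancel₀ two_ne_zero, one_smul, inner_act_left, star_inner, inner_sub_right,
    inner_act_right, act_sub]
  abel

/-- The elements `c` for which the Bergman operator `B(c, c)` vanishes are partial isometries. -/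
theorem act_inner_self_eq_self {c : E}
    (hc : ∀ x : E, (1 - theta A c c) (x - x <• ⟪c, c⟫_A) = 0) : c <• ⟪c, c⟫_A = c := by
  have h := hc c
  set p := ⟪c, c⟫_A with hp
  have h2 : c - c <• p - (c <• p - (c <• p) <• p) = 0 := by
    rw [← h, one_sub_theta_apply, inner_sub_right, inner_act_right, ← hp, act_sub, act_mul]
  -- Pairing with `c` gives `p(1 - p)² = 0`, which is the inner square of `c - c.p`.
  have h3 : p - p * p - (p * p - p * p * p) = 0 := by
    have := congrArg (fun z => ⟪c, z⟫_A) h2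
    simpa only [inner_sub_right, inner_act_right, inner_zero_right, ← hp] using this
  have h4 : ⟪c - c <• p, c - c <• p⟫_A = 0 := by
    rw [← h3]
    simp only [inner_sub_right, inner_sub_left, inner_act_right, inner_act_left, ← hp,
      show star p = p from star_inner_self A c, sub_mul, mul_assoc]
  exact (sub_eq_zero.1 (eq_zero_of_inner_self _ h4)).symm

theorem isStarProjection_inner_self {c : E} (hc : c <• ⟪c, c⟫_A = c) :
    IsStarProjection ⟪c, c⟫_A where
  isIdempotentElem := by
    rw [IsIdempotentElem, ← inner_act_right, hc]
  isSelfAdjoint := isSelfAdjoint_inner_self A c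

theorem norm_le_one_of_act_inner_self {c : E} (hc : c <• ⟪c, c⟫_A = c) : ‖c‖ ≤ 1 :=
  (norm_le_one_iff A c).2 (isStarProjection_inner_self hc).norm_le

/-- If `p` is a projection and `a` is a positive element of `pAp` with `‖p + a‖ ≤ 1`, then
`a = 0`. -/
theorem _root_.IsStarProjection.eq_zero_of_norm_add_le_one {p a : A} (hp : IsStarProjection p)
    (ha : 0 ≤ a) (h : ‖p + a‖ ≤ 1) : p * a * p = 0 := by
  have hpp : p * p = p := hp.isIdempotentElem
  have hps : star p = p := hp.isSelfAdjoint
  -- Compressing `p + a` by `p` gives `p + pap ≤ ‖p + a‖ p ≤ p`.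
  have h1 := CStarAlgebra.star_left_conjugate_le_norm_smul (a := p) (b := p + a)
    (hp.isSelfAdjoint.add (.of_nonneg ha))
  rw [hps, hpp, mul_add, add_mul, hpp, hpp] at h1
  have h2 : ‖p + a‖ • p ≤ p := by
    have := smul_le_smul_of_nonneg_right h hp.nonneg
    rwa [one_smul] at this
  have h3 : p * a * p ≤ 0 := by simpa using h1.trans h2
  refine le_antisymm h3 ?_
  have := star_left_conjugate_nonneg ha p
  rwa [hps] at this

/-- A Bessel inequality for a partial isometry `c`. -/
theorem star_inner_mul_inner_le {c : E} (hc : c <• ⟪c, c⟫_A = c) (z : E) :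
    star ⟪c, z⟫_A * ⟪c, z⟫_A ≤ ⟪z, z⟫_A := by
  have hp : ⟪c, c⟫_A * ⟪c, z⟫_A = ⟪c, z⟫_A := by
    rw [← star_inner_self A c, ← inner_act_left, hc]
  -- The inner square of the residual of `z` along `c` is `⟪z, z⟫ - ⟪c, z⟫⋆⟪c, z⟫`.
  have h := inner_self_nonneg (A := A) (z - c <• ⟪c, z⟫_A)
  rw [← sub_nonneg]
  convert h using 1
  simp only [inner_sub_right, inner_sub_left, inner_act_right, inner_act_left, star_inner,
    sub_mul, mul_assoc, hp]
  abel

theorem norm_inner_le_one {c z : E} (hc : c <• ⟪c, c⟫_A = c) (hz : ‖z‖ ≤ 1) :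
    ‖⟪c, z⟫_A‖ ≤ 1 := by
  have h := CStarAlgebra.norm_le_norm_of_nonneg_of_le (star_mul_self_nonneg _)
    (star_inner_mul_inner_le hc z)
  rw [CStarRing.norm_star_mul_self, ← norm_sq_eq] at h
  nlinarith [norm_nonneg z, norm_nonneg ⟪c, z⟫_A]

/-- A partial isometry whose Bergman operator vanishes is the midpoint of no proper segment in the
unit ball. -/
theorem eq_zero_of_norm_add_le_of_norm_sub_le {c x : E}
    (hc : ∀ x : E, (1 - theta A c c) (x - x <• ⟪c, c⟫_A) = 0)
    (hadd : ‖c + x‖ ≤ 1) (hsub : ‖c - x‖ ≤ 1) : x = 0 := by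
  have hcp := act_inner_self_eq_self hc
  have hproj := isStarProjection_inner_self hcp
  have hnorm : ‖⟪c, c⟫_A + ⟪x, x⟫_A‖ ≤ 1 := by
    have h1 := (norm_le_one_iff A _).1 hadd
    have h2 := (norm_le_one_iff A _).1 hsub
    -- Parallelogram law for the `A`-valued inner product.
    have h3 : (2 : ℂ) • (⟪c, c⟫_A + ⟪x, x⟫_A) = ⟪c + x, c + x⟫_A + ⟪c - x, c - x⟫_A := by
      simp only [inner_sub_right, inner_sub_left, inner_add_right, inner_add_left, two_smul]
      abel
    have h4 := (norm_add_le _ _).trans (add_le_add h1 h2)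
    rw [← h3, norm_smul, Complex.norm_two] at h4
    linarith
  have hxp : x <• ⟪c, c⟫_A = 0 := by
    refine eq_zero_of_inner_self (A := A) _ ?_
    rw [inner_act_right, inner_act_left, star_inner_self]
    exact hproj.eq_zero_of_norm_add_le_one (inner_self_nonneg x) hnorm
  set p := ⟪c, c⟫_A with hp
  set y := ⟪c, x⟫_A with hy
  have hyp : y * p = 0 := by rw [hy, ← inner_act_right, hxp, inner_zero_right]
  have hpy : p * y = y := by rw [hp, hy, ← star_inner_self A c, ← inner_act_left, hcp]
  have hps : star p = p := star_inner_self A c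
  have hpp : p * p = p := hproj.isIdempotentElem
  have hpys : p * star y = 0 := by rw [← star_star p, ← star_mul, hps, hyp, star_zero]
  have hysp : star y * p = star y := by rw [← star_star p, ← star_mul, hps, hpy]
  -- As `y p = 0`, the cross terms of `(p + y)(p + y)⋆` vanish and leave `p + y y⋆`. Since `p y =
  -- y`, compressing `y y⋆` by `p` changes nothing.
  have hyy : y * star y = 0 := by
    have h1 := norm_inner_le_one hcp hadd
    rw [inner_add_right, ← hp, ← hy] at h1
    have h2 : ‖p + y * star y‖ ≤ 1 := by
      have : p + y * star y = (p + y) * star (p + y) := by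
        rw [star_add, hps, add_mul, mul_add, mul_add, hpp, hpys, hyp]
        abel
      rw [this, CStarRing.norm_self_mul_star]
      nlinarith [norm_nonneg (p + y)]
    have h3 := hproj.eq_zero_of_norm_add_le_one (mul_star_self_nonneg y) h2
    rwa [← mul_assoc, hpy, mul_assoc, hysp] at h3
  have hy0 : y = 0 := CStarRing.mul_star_self_eq_zero_iff y |>.1 hyy
  have h := hc x
  rwa [hxp, sub_zero, one_sub_theta_apply, ← hy, hy0, act_zero, sub_zero] at h

/-! ### Extreme points and symmetric perturbations. -/

theorem mem_extrBall_of_forall {c : E} (hc : ‖c‖ ≤ 1)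
    (h : ∀ x : E, ‖c + x‖ ≤ 1 → ‖c - x‖ ≤ 1 → x = 0) : c ∈ extrBall E := by
  refine mem_extremePoints_iff_left.2 ⟨by simpa using hc, ?_⟩
  rintro x₁ hx₁ x₂ hx₂ ⟨s, t, hs, ht, hst, rfl⟩
  have hconv := convex_closedBall (0 : E) 1
  -- Moving the point `s x₁ + t x₂` by `± s t (x₁ - x₂)` stays on the segment `[x₁, x₂]`, so the
  -- symmetric criterion suffices for unequal weights.
  have key : (s * t) • (x₁ - x₂) = 0 := by
    have h1 : s • x₁ + t • x₂ + (s * t) • (x₁ - x₂) ∈ Metric.closedBall (0 : E) 1 := by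
      have : s • x₁ + t • x₂ + (s * t) • (x₁ - x₂) = (s + s * t) • x₁ + (t * t) • x₂ := by
        obtain rfl : s = 1 - t := by linarith
        module
      rw [this]
      exact hconv hx₁ hx₂ (by positivity) (by positivity) (by linear_combination (1 + t) * hst)
    have h2 : s • x₁ + t • x₂ - (s * t) • (x₁ - x₂) ∈ Metric.closedBall (0 : E) 1 := by
      have : s • x₁ + t • x₂ - (s * t) • (x₁ - x₂) = (s * s) • x₁ + (t + s * t) • x₂ := by
        obtain rfl : s = 1 - t := by linarith
        module
      rw [this]
      exact hconv hx₁ hx₂ (by positivity) (by positivity) (by linear_combination (1 + s) * hst)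
    exact h _ (by simpa using h1) (by simpa using h2)
  have h12 : x₁ = x₂ := by
    rcases smul_eq_zero.1 key with h0 | h0
    · exact absurd h0 (mul_pos hs ht).ne'
    · exact sub_eq_zero.1 h0
  rw [← h12, ← add_smul, hst, one_smul]

theorem norm_le_one_of_mem_extrBall {c : E} (hc : c ∈ extrBall E) : ‖c‖ ≤ 1 := by
  simpa using hc.1

theorem eq_zero_of_mem_extrBall {c x : E} (hc : c ∈ extrBall E)
    (hadd : ‖c + x‖ ≤ 1) (hsub : ‖c - x‖ ≤ 1) : x = 0 := by
  have h := (mem_extremePoints_iff_left.1 hc).2 (c + x) (by simpa using hadd) (c - x)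
    (by simpa using hsub) ⟨1 / 2, 1 / 2, by norm_num, by norm_num, by norm_num, by module⟩
  simpa using h

/-- The polynomial is `s(3 - s)²`, at most `4` on `[0, 1]` because `4 - s(3 - s)² = (1 - s)²(4 -
s)`. It is the inner square of `3c - c.p` at `a = p`. -/
theorem norm_mul_three_sub_sq_le {a : A} (ha : 0 ≤ a) (h : ‖a‖ ≤ 1) :
    ‖(9 : ℝ) • a - (6 : ℝ) • (a * a) + a * a * a‖ ≤ 4 := by
  have has : IsSelfAdjoint a := .of_nonneg ha
  have heq : (9 : ℝ) • a - (6 : ℝ) • (a * a) + a * a * a =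
      cfcₙ (fun s : ℝ => 9 * s - 6 * (s * s) + s * s * s) a := by
    rw [cfcₙ_add (R := ℝ) (fun s : ℝ => 9 * s - 6 * (s * s)) (fun s => s * s * s) a,
      cfcₙ_sub (R := ℝ) (fun s : ℝ => 9 * s) (fun s => 6 * (s * s)) a,
      cfcₙ_const_mul (R := ℝ) 9 (fun s => s) a, cfcₙ_const_mul (R := ℝ) 6 (fun s => s * s) a,
      cfcₙ_mul (R := ℝ) (fun s => s * s) (fun s => s) a,
      cfcₙ_mul (R := ℝ) (fun s => s) (fun s => s) a, cfcₙ_id' ℝ a]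
  rw [heq]
  refine norm_cfcₙ_le fun s hs => ?_
  have h0 : 0 ≤ s := quasispectrum_nonneg_of_nonneg a ha s hs
  have h1 : s ≤ 1 :=
    (Real.le_norm_self s).trans ((NonUnitalIsometricContinuousFunctionalCalculus.norm_quasispectrum_le
      a hs has).trans h)
  rw [Real.norm_eq_abs, abs_le]
  constructor
  · nlinarith [mul_nonneg h0 (sq_nonneg (3 - s))]
  · nlinarith [mul_nonneg (sub_nonneg.2 h1) (sub_nonneg.2 h1),
      mul_nonneg (show 0 ≤ 4 - s by linarith) (sq_nonneg (1 - s))]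

/-- Perturb by `x = (c - c.p)/2`. In terms of a spectral value `t` of `|c|`, `c ± x` have moduli
`t(3 - t²)/2` and `t(1 + t²)/2`, both at most `1` on `[0, 1]`; extremality gives `x = 0`. -/
theorem act_inner_self_of_mem_extrBall {c : E} (hc : c ∈ extrBall E) : c <• ⟪c, c⟫_A = c := by
  have hc1 := norm_le_one_of_mem_extrBall hc
  have hp1 := (norm_le_one_iff A c).1 hc1
  have hp0 := inner_self_nonneg (A := A) c
  set p := ⟪c, c⟫_A with hp
  have hps : star p = p := star_inner_self A c
  have hcp : ‖c <• p‖ ≤ 1 := by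
    rw [norm_le_one_iff A, inner_act_right, inner_act_left, hps, ← hp]
    calc ‖p * p * p‖ ≤ ‖p‖ * ‖p‖ * ‖p‖ :=
          (norm_mul_le _ _).trans (mul_le_mul_of_nonneg_right (norm_mul_le _ _) (norm_nonneg _))
      _ ≤ 1 := mul_le_one₀ (mul_le_one₀ hp1 (norm_nonneg _) hp1) (norm_nonneg _) hp1
  have hadd : ‖c + (2⁻¹ : ℂ) • (c - c <• p)‖ ≤ 1 := by
    have h1 : c + (2⁻¹ : ℂ) • (c - c <• p) = (2⁻¹ : ℂ) • ((3 : ℂ) • c - c <• p) := by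
      generalize c <• p = d
      module
    have h2 : ‖(3 : ℂ) • c - c <• p‖ ^ 2 ≤ 4 := by
      rw [norm_sq_eq (A := A)]
      convert norm_mul_three_sub_sq_le hp0 hp1 using 2
      simp only [inner_sub_right, inner_sub_left, inner_act_right, inner_act_left,
        inner_smul_right, inner_smul_left, ← hp, hps, smul_sub, sub_mul, smul_mul_assoc, mul_assoc]
      have h9 : star (3 : ℂ) = 3 := by simp
      rw [h9, ← Complex.coe_smul, ← Complex.coe_smul]
      push_cast
      module
    rw [h1, norm_smul]
    have : ‖(2⁻¹ : ℂ)‖ = 2⁻¹ := by simp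
    rw [this]
    nlinarith [norm_nonneg ((3 : ℂ) • c - c <• p)]
  have hsub : ‖c - (2⁻¹ : ℂ) • (c - c <• p)‖ ≤ 1 := by
    have h1 : c - (2⁻¹ : ℂ) • (c - c <• p) = (2⁻¹ : ℂ) • (c + c <• p) := by
      generalize c <• p = d
      module
    have h2 := (norm_add_le c (c <• p)).trans (add_le_add hc1 hcp)
    rw [h1, norm_smul]
    have : ‖(2⁻¹ : ℂ)‖ = 2⁻¹ := by simp
    rw [this]
    linarith
  have h := eq_zero_of_mem_extrBall hc hadd hsub
  rw [smul_eq_zero, or_iff_right (by norm_num), sub_eq_zero] at h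
  exact h.symm

/-- The inner squares of `c` and `y` are self-adjoint with product zero, so the norm of their sum is
the maximum of their norms. -/
theorem norm_add_le_one_of_orthogonal {c y : E} (hc : ‖c‖ ≤ 1) (hy : ‖y‖ ≤ 1)
    (hcy : ⟪c, y⟫_A = 0) (hyc : y <• ⟪c, c⟫_A = 0) : ‖c + y‖ ≤ 1 := by
  have hyc' : ⟪y, c⟫_A = 0 := by rw [← star_inner c y, hcy, star_zero]
  have hmul : ⟪y, y⟫_A * ⟪c, c⟫_A = 0 := by rw [← inner_act_right, hyc, inner_zero_right]
  rw [norm_le_one_iff A] at hc hy ⊢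
  have h : ⟪c + y, c + y⟫_A = ⟪y, y⟫_A + ⟪c, c⟫_A := by
    rw [inner_add_right, inner_add_left, inner_add_left, hcy, hyc']
    abel
  rw [h, (isSelfAdjoint_inner_self A y).norm_add_eq_max (isSelfAdjoint_inner_self A c) hmul]
  exact max_le hy hc

theorem eq_zero_of_orthogonal_of_mem_extrBall {c y : E} (hc : c ∈ extrBall E)
    (hcy : ⟪c, y⟫_A = 0) (hyc : y <• ⟪c, c⟫_A = 0) : y = 0 := by
  by_contra hy
  have hn : (‖y‖⁻¹ : ℂ) ≠ 0 := by simpa using hy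
  have hc1 := norm_le_one_of_mem_extrBall hc
  have hz1 : ‖(‖y‖⁻¹ : ℂ) • y‖ ≤ 1 := by
    rw [norm_smul, norm_inv, Complex.norm_real, norm_norm, inv_mul_cancel₀ (norm_ne_zero_iff.2 hy)]
  have hcz : ⟪c, (‖y‖⁻¹ : ℂ) • y⟫_A = 0 := by rw [inner_smul_right, hcy, smul_zero]
  have hzc : ((‖y‖⁻¹ : ℂ) • y) <• ⟪c, c⟫_A = 0 := by rw [smul_act, hyc, smul_zero]
  have h := eq_zero_of_mem_extrBall hc (norm_add_le_one_of_orthogonal hc1 hz1 hcz hzc) (by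
    rw [sub_eq_add_neg]
    exact norm_add_le_one_of_orthogonal (A := A) hc1 (by rwa [norm_neg])
      (by rw [inner_neg_right, hcz, neg_zero]) (by rw [neg_act, hzc, neg_zero]))
  exact (smul_ne_zero hn hy) h

/-! ### The characterization of extreme points. -/

variable (A) in
theorem mem_extrBall_iff (c : E) :
    c ∈ extrBall E ↔ ∀ x : E, (1 - theta A c c) (x - x <• ⟪c, c⟫_A) = 0 := by
  refine ⟨fun hc x => ?_, fun hc => mem_extrBall_of_forall
    (norm_le_one_of_act_inner_self (act_inner_self_eq_self hc))
    fun x => eq_zero_of_norm_add_le_of_norm_sub_le hc⟩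
  have hcp : c <• ⟪c, c⟫_A = c := act_inner_self_of_mem_extrBall hc
  have hpp : ⟪c, c⟫_A * ⟪c, c⟫_A = ⟪c, c⟫_A := (isStarProjection_inner_self hcp).isIdempotentElem
  have hp (z : E) : ⟪c, c⟫_A * ⟪c, z⟫_A = ⟪c, z⟫_A := by
    rw [← star_inner_self A c, ← inner_act_left, hcp]
  -- Since `p` is a projection and `c = c.p`, the range of `B(c,c)` is orthogonal to `c` on both
  -- sides.
  apply eq_zero_of_orthogonal_of_mem_extrBall (A := A) hc
  · rw [one_sub_theta_apply, inner_sub_right, inner_act_right, hp, sub_self]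
  · simp only [one_sub_theta_apply, sub_act, ← act_mul, inner_sub_right, inner_act_right, hpp,
      sub_mul, mul_assoc, sub_self, act_zero]

end Basic

end RightHilbertModule

theorem mainTheorem3 (A E : Type*) [NonUnitalCStarAlgebra A] [PartialOrder A] [StarOrderedRing A]
    [NormedAddCommGroup E] [NormedSpace ℂ E] [CompleteSpace E] [SMul Aᵐᵒᵖ E]
    [RightHilbertModule A E] :
    RightHilbertModule.extrBall E = {c : E | RightHilbertModule.bergman A c c = 0} ∧
    (∀ c : E, c ∈ RightHilbertModule.extrBall E ↔
      ∀ x : E, (1 - RightHilbertModule.theta A c c)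
        (RightHilbertModule.unitAct x
          (1 - (RightHilbertModule.absVal A c : Unitization ℂ A) ^ 2)) = 0) ∧
    (∀ c : E,
      (∀ x : E, RightHilbertModule.unitAct x
        (1 - (RightHilbertModule.absVal A c : Unitization ℂ A)) = 0) →
      c ∈ RightHilbertModule.extrBall E) ∧
    (∀ c : E, (∀ x : E, (1 - RightHilbertModule.theta A c c) x = 0) →
      c ∈ RightHilbertModule.extrBall E) ∧
    (∀ c ∈ RightHilbertModule.extrBall E,
      RightHilbertModule.triple A c c c = c ∧ c <• ⟪c, c⟫_A = c) := by
  open RightHilbertModule in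
  refine ⟨?_, fun c => ?_, fun c h => ?_, fun c h => ?_, fun c hc => ?_⟩
  · ext c
    rw [mem_extrBall_iff A, Set.mem_ofPred_eq, LinearMap.ext_iff]
    simp only [bergman_self_apply, LinearMap.zero_apply]
  · simp only [mem_extrBall_iff A, unitAct_one_sub_absVal_sq]
  · refine (mem_extrBall_iff A c).2 fun x => ?_
    have hx (z : E) : z <• absVal A c = z := by
      have := h z
      rw [unitAct_one_sub_inr, sub_eq_zero] at this
      exact this.symm
    rw [← absVal_mul_absVal, act_mul, hx, hx, sub_self, map_zero]
  · exact (mem_extrBall_iff A c).2 fun x => h _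
  · have hcp : c <• ⟪c, c⟫_A = c := act_inner_self_of_mem_extrBall hc
    exact ⟨by rw [triple_self_outer, hcp], hcp⟩
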